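/- Let $n\ge 2$ and let $\Gamma\subsetneq\mathbb{R}^n$ be a non-empty open symmetric (i.e. invariant under permutations of the coordinates) cone with vertex at the origin such that $\Gamma+\Gamma_n\subset\Gamma$, where $\Gamma_n=\{\lambda\in\mathbb{R}^n : \lambda_i>0 \text{ for all } i\}$. Let $\lambda^*=(1,-1,\dots,-1)\in\mathbb{R}^n$ and let $B\subset\mathbb{R}^n$ be the open unit ball centered at $0$. For $\varphi$ of class $C^2$ put $A[\varphi]=e^{-2\varphi}\left(-\nabla^2\varphi+\nabla\varphi\otimes\nabla\varphi-\tfrac12|\nabla\varphi|^2 I\right)$, and let $\lambda(M)$ denote the vector of eigenvalues of a symmetric matrix $M$ (modulo permutations). For an open set $\Omega\subset\mathbb{R}^n$, $LSC(\Omega)$ is the set of lower semicontinuous functions $v:\Omega\to(-\infty,+\infty]$ with $v\not\equiv+\infty$. One says that $\lambda(A[v])\in\overline\Gamma$ in $\Omega$ in the viscosity sense if $v\in LSC(\Omega)$ and, for every $x_0\in\Omega$ and every $C^2$ function $\varphi$ with $\varphi(x_0)=v(x_0)$ and $\varphi\le v$ near $x_0$, one has $\lambda(A[\varphi])(x_0)\in\overline\Gamma$.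 A function $v\in LSC(\Omega)$ is lowerconical at $x_0\in\Omega$ if either $v(x_0)=+\infty$, or $v(x_0)<+\infty$ and for all $\varepsilon>0$ and all $\eta\in C^\infty(\Omega)$ $$\inf_{x\in\Omega}\big((v-\eta)(x)-(v-\eta)(x_0)-\varepsilon|x-x_0|\big)<0.$$ (a) If $\lambda^*\notin\overline\Gamma$ and $v$ satisfies $\lambda(A[v])\in\overline\Gamma$ in $B\setminus\{0\}$ in the viscosity sense, then $\liminf_{x\to0}v(x)\in(-\infty,+\infty]$ (the $\liminf$ is over $x\neq 0$). Moreover, if we define $v(0)=\liminf_{x\to0}v(x)$, then $v\in LSC(B)$ and $v$ is lowerconical at $0$. (b) The condition in (a) is optimal: if $\lambda^*\in\overline\Gamma$, then there exists $v$ satisfying $\lambda(A[v])\in\overline\Gamma$ in $B\setminus\{0\}$ in the viscosity sense with $\liminf_{x\to0}v(x)=-\infty$. -/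

import Mathlib

open Set Filter Topology
open scoped ContDiff

/-- Conditions on the cone `Γ`: a non-empty, proper, open, symmetric subset of `ℝⁿ`, which is a
cone with vertex at the origin and satisfies `Γ + Γₙ ⊆ Γ`, where `Γₙ` is the positive orthant. -/
structure IsAdmissibleCone {n : ℕ} (Γ : Set (Fin n → ℝ)) : Prop where
  nonempty : Γ.Nonempty
  ne_univ : Γ ≠ univ
  isOpen : IsOpen Γ
  symmetric : ∀ l ∈ Γ, ∀ σ : Equiv.Perm (Fin n), l ∘ σ ∈ Γ
  cone : ∀ l ∈ Γ, ∀ t : ℝ, 0 < t → t • l ∈ Γ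
  add_pos : ∀ l ∈ Γ, ∀ m : Fin n → ℝ, (∀ i, 0 < m i) → l + m ∈ Γ

/-- The vector `λ* = (1, -1, …, -1)`. -/
def lambdaStar (n : ℕ) : Fin n → ℝ := fun i => if (i : ℕ) = 0 then 1 else -1

/-- The partial derivative `∂φ/∂xᵢ`. -/
noncomputable def partialDeriv {n : ℕ} (i : Fin n) (φ : EuclideanSpace ℝ (Fin n) → ℝ)
    (x : EuclideanSpace ℝ (Fin n)) : ℝ :=
  fderiv ℝ φ x (EuclideanSpace.single i 1)

/-- The Möbius Hessian `A[φ] = e^{-2φ} (-∇²φ + ∇φ ⊗ ∇φ - ½ |∇φ|² I)` at the point `x`. -/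
noncomputable def moebiusHessian {n : ℕ} (φ : EuclideanSpace ℝ (Fin n) → ℝ)
    (x : EuclideanSpace ℝ (Fin n)) : Matrix (Fin n) (Fin n) ℝ :=
  Real.exp (-2 * φ x) •
    (-(Matrix.of fun i j => partialDeriv i (partialDeriv j φ) x)
      + Matrix.vecMulVec (fun i => partialDeriv i φ x) (fun i => partialDeriv i φ x)
      - ((1 / 2 : ℝ) * ∑ k, (partialDeriv k φ x) ^ 2) • (1 : Matrix (Fin n) (Fin n) ℝ))

/-- `λ(M) ∈ S` for a symmetric matrix `M`: the vector of eigenvalues of `M`, counted with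
multiplicity, lies in `S`. It is used for permutation-invariant `S` only, so that the order of the
eigenvalues does not matter. -/
def EigenvaluesIn {n : ℕ} (M : Matrix (Fin n) (Fin n) ℝ) (S : Set (Fin n → ℝ)) : Prop :=
  ∃ hM : M.IsHermitian, hM.eigenvalues ∈ S

/-- `v ∈ LSC(Ω)`: on the open set `Ω` the function `v` takes values in `(-∞, +∞]`, is not
identically `+∞`, and is lower semicontinuous. Values of `v` outside `Ω` are irrelevant. -/
def IsLSC {n : ℕ} (Ω : Set (EuclideanSpace ℝ (Fin n))) (v : EuclideanSpace ℝ (Fin n) → EReal) :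
    Prop :=
  (∀ x ∈ Ω, v x ≠ ⊥) ∧ (∃ x ∈ Ω, v x ≠ ⊤) ∧ LowerSemicontinuousOn v Ω

/-- `λ(A[v]) ∈ closure Γ` in the open set `Ω`, in the viscosity sense: `v ∈ LSC(Ω)`, and
`λ(A[φ])(x₀) ∈ closure Γ` whenever `x₀ ∈ Ω` and `φ` is a `C²` function near `x₀` that touches `v`
from below at `x₀`. -/
def IsViscositySupersolution {n : ℕ} (Γ : Set (Fin n → ℝ)) (Ω : Set (EuclideanSpace ℝ (Fin n)))
    (v : EuclideanSpace ℝ (Fin n) → EReal) : Prop :=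
  IsLSC Ω v ∧
    ∀ x₀ ∈ Ω, ∀ φ : EuclideanSpace ℝ (Fin n) → ℝ, ContDiffAt ℝ 2 φ x₀ →
      (φ x₀ : EReal) = v x₀ → (∀ᶠ x in 𝓝 x₀, (φ x : EReal) ≤ v x) →
      EigenvaluesIn (moebiusHessian φ x₀) (closure Γ)

/-- The function `φ ∈ LSC(Ω)` is lowerconical at `x₀ ∈ Ω`. -/
def IsLowerConicalAt {n : ℕ} (Ω : Set (EuclideanSpace ℝ (Fin n)))
    (φ : EuclideanSpace ℝ (Fin n) → EReal) (x₀ : EuclideanSpace ℝ (Fin n)) : Prop :=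
  IsLSC Ω φ ∧ x₀ ∈ Ω ∧
    (φ x₀ = ⊤ ∨
      (φ x₀ < ⊤ ∧ ∀ ε : ℝ, 0 < ε → ∀ η : EuclideanSpace ℝ (Fin n) → ℝ, ContDiffOn ℝ ∞ η Ω →
        (⨅ x ∈ Ω, ((φ x - (η x : EReal)) - (φ x₀ - (η x₀ : EReal))
          - ((ε * ‖x - x₀‖ : ℝ) : EReal))) < 0))

/-!
The closure of an admissible cone is symmetric, invariant under positive dilations and upward
closed. Hence only two facts about eigenvalues matter, both read off the quadratic form of a
symmetric matrix `M`, with `e` a unit vector: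

* if `M ≥ κ (2 e ⊗ e - I)` with `κ > 0`, the eigenvalues of `M` dominate a permutation of `κ λ*`
  (`IsAdmissibleCone.eigenvaluesIn_closure`);
* if `M ≤ σ ((2 + δ) e ⊗ e - I)` with `σ > 0`, they are dominated by a permutation of
  `σ (1 + δ, -1, …, -1)` (`IsAdmissibleCone.lambdaStar_add_mem_closure`).

When `λ*` lies in the closure, `v = log |x|` is a supersolution tending to `-∞`: its Möbius Hessian
is a positive multiple of `2 e ⊗ e - I` with `e = x / |x|`, and a `C²` function touching `v` from
below has a larger Möbius Hessian.

When `λ*` is not in the closure, neither is `λ* + δ e₀` for some `δ > 0`, which leaves room for the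
barriers `c + ⟪p, x⟫ + N |x|² + β⁻¹ log (1 - ρ |x| ^ (-2 β))`. For small `β`, large `N` and small
`|x|` their Möbius Hessian violates the cone condition, they tend to `-∞` at the sphere
`|x| ^ (2 β) = ρ`, and they converge to `c + ⟪p, x⟫ + N |x|²` as `ρ → 0`. So they can be compared with
a supersolution `v` on an annulus without any knowledge of `v` near the origin, and a bound
`v ≥ c + ⟪p, x⟫ + N |x|²` on a sphere `|x| = r` propagates to the punctured ball
(`IsViscositySupersolution.le_of_le_on_sphere`). With `p = 0` and `N = 0` this bounds `v` from below.
If `v` were not lowerconical at the origin, then `v ≥ v(0) + ⟪p, x⟫ + (3/4) ε |x|` nearby, where `p` is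
the gradient of the smooth function; propagating from a small sphere the bound with
`c = v(0) + ε r / 2` gives `liminf v > v(0)`, a contradiction.
-/

/-! ### The closure of an admissible cone -/

namespace IsAdmissibleCone

variable {n : ℕ} {Γ : Set (Fin n → ℝ)}

lemma comp_perm_mem_closure (hΓ : IsAdmissibleCone Γ) {l : Fin n → ℝ} (hl : l ∈ closure Γ)
    (σ : Equiv.Perm (Fin n)) : l ∘ σ ∈ closure Γ :=
  map_mem_closure (f := fun l : Fin n → ℝ => l ∘ σ) (by fun_prop) hl
    fun m hm => hΓ.symmetric m hm σ

lemma smul_mem_closure (hΓ : IsAdmissibleCone Γ) {l : Fin n → ℝ} (hl : l ∈ closure Γ)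
    {t : ℝ} (ht : 0 < t) : t • l ∈ closure Γ :=
  map_mem_closure (f := fun l : Fin n → ℝ => t • l) (by fun_prop) hl
    fun m hm => hΓ.cone m hm t ht

lemma mem_closure_of_le (hΓ : IsAdmissibleCone Γ) {l m : Fin n → ℝ} (hl : l ∈ closure Γ)
    (hlm : l ≤ m) : m ∈ closure Γ := by
  have key : ∀ t : ℝ, 0 < t → m + t • (1 : Fin n → ℝ) ∈ closure Γ := by
    intro t ht
    have h := map_mem_closure (f := fun k : Fin n → ℝ => k + (m - l + t • 1))
      (t := Γ) (by fun_prop) hl fun k hk => hΓ.add_pos k hk _ fun i => by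
        have := hlm i
        simp only [Pi.add_apply, Pi.sub_apply, Pi.smul_apply, Pi.one_apply, smul_eq_mul]
        linarith
    convert h using 1
    abel
  have hlim : Tendsto (fun t : ℝ => m + t • (1 : Fin n → ℝ)) (𝓝[>] 0) (𝓝 m) := by
    have : ContinuousAt (fun t : ℝ => m + t • (1 : Fin n → ℝ)) 0 := by fun_prop
    simpa using this.tendsto.mono_left (nhdsWithin_le_nhds (s := Ioi 0))
  exact isClosed_closure.mem_of_tendsto hlim (eventually_mem_nhdsWithin.mono key)

end IsAdmissibleCone

/-! ### Eigenvalue bounds from quadratic form bounds -/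

section Eigenvalues

variable {n : ℕ} {M : Matrix (Fin n) (Fin n) ℝ}

open scoped RealInnerProductSpace

lemma Matrix.IsHermitian.dotProduct_mulVec_eq_sum (hM : M.IsHermitian)
    (ξ : EuclideanSpace ℝ (Fin n)) :
    ξ.ofLp ⬝ᵥ M.mulVec ξ.ofLp = ∑ i, hM.eigenvalues i * ⟪hM.eigenvectorBasis i, ξ⟫ ^ 2 := by
  have h1 : ξ.ofLp ⬝ᵥ M.mulVec ξ.ofLp = ⟪ξ, WithLp.toLp 2 (M.mulVec ξ.ofLp)⟫ := by
    simp [EuclideanSpace.inner_eq_star_dotProduct, dotProduct_comm]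
  rw [h1, ← hM.eigenvectorBasis.sum_inner_mul_inner]
  refine Finset.sum_congr rfl fun i _ => ?_
  have h2 : ⟪hM.eigenvectorBasis i, WithLp.toLp 2 (M.mulVec ξ.ofLp)⟫
      = hM.eigenvalues i * ⟪hM.eigenvectorBasis i, ξ⟫ := by
    have hT : M.transpose = M := by simpa [Matrix.IsHermitian] using hM
    simp only [EuclideanSpace.inner_eq_star_dotProduct, star_trivial]
    rw [dotProduct_comm, Matrix.dotProduct_mulVec, ← Matrix.mulVec_transpose, hT,
      hM.mulVec_eigenvectorBasis, smul_dotProduct, dotProduct_comm, smul_eq_mul]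
  rw [h2, real_inner_comm]
  ring

lemma Matrix.IsHermitian.eigenvalues_eq_dotProduct (hM : M.IsHermitian) (i : Fin n) :
    hM.eigenvalues i = (hM.eigenvectorBasis i).ofLp ⬝ᵥ M.mulVec (hM.eigenvectorBasis i).ofLp := by
  rw [hM.dotProduct_mulVec_eq_sum, Finset.sum_eq_single i]
  · simp
  · intro j _ hj
    simp [hM.eigenvectorBasis.inner_eq_ite, hj]
  · simp

/-- At most one eigenvalue can exceed `-σ`, since two such eigenvectors would span a vector
orthogonal to `e`. -/
lemma Matrix.IsHermitian.eq_of_neg_lt_eigenvalues (hM : M.IsHermitian)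
    {e : EuclideanSpace ℝ (Fin n)} {σ δ : ℝ}
    (h : ∀ ξ : EuclideanSpace ℝ (Fin n),
      ξ.ofLp ⬝ᵥ M.mulVec ξ.ofLp ≤ σ * ((2 + δ) * ⟪e, ξ⟫ ^ 2 - ‖ξ‖ ^ 2))
    {i j : Fin n} (hi : -σ < hM.eigenvalues i) (hj : -σ < hM.eigenvalues j) : i = j := by
  by_contra hij
  set b := hM.eigenvectorBasis with hb
  set α := ⟪e, b j⟫ with hα
  set γ := ⟪e, b i⟫ with hγ
  have hQi := h (b i)
  rw [← hM.eigenvalues_eq_dotProduct, b.norm_eq_one, ← hγ] at hQi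
  have hγ0 : γ ≠ 0 := by
    intro h0
    rw [h0] at hQi
    linarith
  have hQ := h (α • b i - γ • b j)
  have hin : ⟪e, α • b i - γ • b j⟫ = 0 := by
    rw [inner_sub_right, inner_smul_right, inner_smul_right, ← hα, ← hγ]; ring
  have hnorm : ‖α • b i - γ • b j‖ ^ 2 = α ^ 2 + γ ^ 2 := by
    rw [← real_inner_self_eq_norm_sq]
    simp only [inner_sub_left, inner_sub_right, inner_smul_left, inner_smul_right,
      b.inner_eq_ite, hij, Ne.symm hij, if_true, if_false, RCLike.conj_to_real]
    ring
  rw [hin, hnorm, hM.dotProduct_mulVec_eq_sum] at hQ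
  have hsum : ∑ k, hM.eigenvalues k * ⟪b k, α • b i - γ • b j⟫ ^ 2
      = hM.eigenvalues i * α ^ 2 + hM.eigenvalues j * γ ^ 2 := by
    rw [Fintype.sum_eq_add i j hij]
    · simp [inner_sub_right, inner_smul_right, b.inner_eq_ite, hij, Ne.symm hij]
    · rintro k ⟨hki, hkj⟩
      simp [inner_sub_right, inner_smul_right, b.inner_eq_ite, hki, hkj]
  rw [← hb, hsum] at hQ
  have := mul_pos (sub_pos.2 hj) (pow_pos (abs_pos.2 hγ0) 2)
  rw [sq_abs] at this
  nlinarith [mul_nonneg (sub_pos.2 hi).le (sq_nonneg α)]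

/-- If `M ≤ σ ((2 + δ) e ⊗ e - I)` with `e` a unit vector, the eigenvalues of `M` lie below a
permutation of `σ (1 + δ, -1, …, -1)`. -/
lemma IsAdmissibleCone.lambdaStar_add_mem_closure {Γ : Set (Fin n → ℝ)} (hΓ : IsAdmissibleCone Γ)
    (hM : EigenvaluesIn M (closure Γ)) (i₀ : Fin n) (hi₀ : (i₀ : ℕ) = 0)
    {e : EuclideanSpace ℝ (Fin n)} (he : ‖e‖ = 1) {σ δ : ℝ} (hσ : 0 < σ) (hδ : 0 < δ)
    (h : ∀ ξ : EuclideanSpace ℝ (Fin n),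
      ξ.ofLp ⬝ᵥ M.mulVec ξ.ofLp ≤ σ * ((2 + δ) * ⟪e, ξ⟫ ^ 2 - ‖ξ‖ ^ 2)) :
    lambdaStar n + Pi.single i₀ δ ∈ closure Γ := by
  obtain ⟨hM, hmem⟩ := hM
  have hle : ∀ i, hM.eigenvalues i ≤ σ * (1 + δ) := by
    intro i
    have h1 := h (hM.eigenvectorBasis i)
    rw [← hM.eigenvalues_eq_dotProduct, hM.eigenvectorBasis.norm_eq_one] at h1
    have h2 := abs_real_inner_le_norm e (hM.eigenvectorBasis i)
    rw [he, hM.eigenvectorBasis.norm_eq_one, mul_one, abs_le_one_iff_mul_self_le_one] at h2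
    refine h1.trans (mul_le_mul_of_nonneg_left ?_ hσ.le)
    nlinarith
  obtain ⟨k, hk⟩ : ∃ k, ∀ i ≠ k, hM.eigenvalues i ≤ -σ := by
    by_cases hex : ∃ k, -σ < hM.eigenvalues k
    · obtain ⟨k, hk⟩ := hex
      refine ⟨k, fun i hik => ?_⟩
      by_contra hi
      exact hik (hM.eq_of_neg_lt_eigenvalues h (not_le.1 hi) hk)
    · push Not at hex
      exact ⟨i₀, fun i _ => hex i⟩
  have h1 := hΓ.smul_mem_closure (hΓ.comp_perm_mem_closure hmem (Equiv.swap i₀ k)) (inv_pos.2 hσ)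
  refine hΓ.mem_closure_of_le h1 fun i => ?_
  simp only [Pi.smul_apply, Function.comp_apply, smul_eq_mul, Pi.add_apply, lambdaStar]
  rw [inv_mul_le_iff₀ hσ]
  by_cases hi : i = i₀
  · subst hi
    simpa [hi₀] using hle k
  · have hi' : (i : ℕ) ≠ 0 := fun h0 => hi (Fin.ext (h0.trans hi₀.symm))
    have := hk (Equiv.swap i₀ k i) fun hc => hi <| by
      simpa using congrArg (Equiv.swap i₀ k) hc
    simpa [hi', hi] using this

/-- If `M ≥ κ (2 e ⊗ e - I)` with `e` a unit vector, the eigenvalues of `M` lie above a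
permutation of `κ λ*`. -/
lemma IsAdmissibleCone.eigenvaluesIn_closure {Γ : Set (Fin n → ℝ)} (hΓ : IsAdmissibleCone Γ)
    (hlam : lambdaStar n ∈ closure Γ) (hM : M.IsHermitian) (i₀ : Fin n) (hi₀ : (i₀ : ℕ) = 0)
    {e : EuclideanSpace ℝ (Fin n)} (he : ‖e‖ = 1) {κ : ℝ} (hκ : 0 < κ)
    (h : ∀ ξ : EuclideanSpace ℝ (Fin n),
      κ * (2 * ⟪e, ξ⟫ ^ 2 - ‖ξ‖ ^ 2) ≤ ξ.ofLp ⬝ᵥ M.mulVec ξ.ofLp) :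
    EigenvaluesIn M (closure Γ) := by
  refine ⟨hM, ?_⟩
  have hge : ∀ i, -κ ≤ hM.eigenvalues i := by
    intro i
    have h1 := h (hM.eigenvectorBasis i)
    rw [← hM.eigenvalues_eq_dotProduct, hM.eigenvectorBasis.norm_eq_one] at h1
    nlinarith [mul_nonneg hκ.le (sq_nonneg ⟪e, hM.eigenvectorBasis i⟫)]
  obtain ⟨k, hk⟩ : ∃ k, κ ≤ hM.eigenvalues k := by
    by_contra! hlt
    have h1 := h e
    rw [hM.dotProduct_mulVec_eq_sum, real_inner_self_eq_norm_sq, he] at h1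
    have h2 : ∑ i, ⟪hM.eigenvectorBasis i, e⟫ ^ 2 = 1 := by
      have := hM.eigenvectorBasis.sum_inner_mul_inner e e
      rw [real_inner_self_eq_norm_sq, he, one_pow] at this
      rw [← this]
      exact Finset.sum_congr rfl fun i _ => by rw [real_inner_comm, sq]
    have h3 : ∑ i, (κ - hM.eigenvalues i) * ⟪hM.eigenvectorBasis i, e⟫ ^ 2 ≤ 0 := by
      simp only [sub_mul, Finset.sum_sub_distrib, ← Finset.mul_sum, h2]
      linarith
    have h4 : ∀ i ∈ Finset.univ, 0 ≤ (κ - hM.eigenvalues i) * ⟪hM.eigenvectorBasis i, e⟫ ^ 2 :=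
      fun i _ => mul_nonneg (sub_pos.2 (hlt i)).le (sq_nonneg _)
    have h5 := (Finset.sum_eq_zero_iff_of_nonneg h4).1 (le_antisymm h3 (Finset.sum_nonneg h4))
    have h6 : ∑ i, ⟪hM.eigenvectorBasis i, e⟫ ^ 2 = 0 := Finset.sum_eq_zero fun i hi =>
      (mul_eq_zero.1 (h5 i hi)).resolve_left (sub_pos.2 (hlt i)).ne'
    linarith
  have h1 := hΓ.smul_mem_closure (hΓ.comp_perm_mem_closure hlam (Equiv.swap i₀ k)) hκ
  refine hΓ.mem_closure_of_le h1 fun i => ?_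
  simp only [Pi.smul_apply, Function.comp_apply, smul_eq_mul, lambdaStar]
  by_cases hi : i = k
  · subst hi
    simpa [hi₀] using hk
  · have hi' : ((Equiv.swap i₀ k i : Fin n) : ℕ) ≠ 0 := fun h0 => hi <| by
      have : Equiv.swap i₀ k i = i₀ := Fin.ext (h0.trans hi₀.symm)
      simpa using congrArg (Equiv.swap i₀ k) this
    simpa [hi'] using hge i

end Eigenvalues

/-! ### The Möbius Hessian as a quadratic form -/

section Calculus

variable {n : ℕ} {φ : EuclideanSpace ℝ (Fin n) → ℝ} {x : EuclideanSpace ℝ (Fin n)}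

open scoped RealInnerProductSpace

lemma partialDeriv_partialDeriv (hφ : ContDiffAt ℝ 2 φ x) (i j : Fin n) :
    partialDeriv i (partialDeriv j φ) x
      = fderiv ℝ (fderiv ℝ φ) x (EuclideanSpace.single i 1) (EuclideanSpace.single j 1) := by
  have hd : DifferentiableAt ℝ (fderiv ℝ φ) x :=
    (hφ.fderiv_right (m := 1) (by norm_num)).differentiableAt (by norm_num)
  unfold partialDeriv
  rw [fderiv_clm_apply hd (by fun_prop)]
  simp

lemma isHermitian_moebiusHessian (hφ : ContDiffAt ℝ 2 φ x) : (moebiusHessian φ x).IsHermitian := by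
  have hs := hφ.isSymmSndFDerivAt (by simp)
  ext i j
  simp only [Matrix.conjTranspose_apply, star_trivial, moebiusHessian, Matrix.smul_apply,
    Matrix.sub_apply, Matrix.add_apply, Matrix.neg_apply, Matrix.of_apply,
    Matrix.vecMulVec_apply, partialDeriv_partialDeriv hφ, Matrix.one_apply]
  rw [hs.eq, mul_comm (partialDeriv j φ x)]
  simp only [eq_comm (a := i)]

lemma dotProduct_moebiusHessian_mulVec (hφ : ContDiffAt ℝ 2 φ x) {g : EuclideanSpace ℝ (Fin n)}
    (hg : HasFDerivAt φ (innerSL ℝ g) x) (ξ : EuclideanSpace ℝ (Fin n)) :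
    ξ.ofLp ⬝ᵥ (moebiusHessian φ x).mulVec ξ.ofLp = Real.exp (-2 * φ x) *
      (-(fderiv ℝ (fderiv ℝ φ) x ξ ξ) + ⟪g, ξ⟫ ^ 2 - 1 / 2 * ‖g‖ ^ 2 * ‖ξ‖ ^ 2) := by
  have hpd : ∀ i, partialDeriv i φ x = g.ofLp i := by
    intro i
    simp [partialDeriv, hg.fderiv, EuclideanSpace.inner_single_right]
  have hξ : ξ = ∑ i, ξ.ofLp i • EuclideanSpace.single i (1 : ℝ) := by
    have := (EuclideanSpace.basisFun (Fin n) ℝ).sum_repr ξ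
    simpa using this.symm
  have hD : fderiv ℝ (fderiv ℝ φ) x ξ ξ
      = ξ.ofLp ⬝ᵥ (Matrix.of fun i j => partialDeriv i (partialDeriv j φ) x).mulVec ξ.ofLp := by
    simp only [partialDeriv_partialDeriv hφ]
    conv_lhs => rw [hξ]
    simp only [map_sum, sum_apply, map_smul, smul_apply,
      dotProduct, Matrix.mulVec, Matrix.of_apply, smul_eq_mul, Finset.mul_sum]
    rw [Finset.sum_comm]
    refine Finset.sum_congr rfl fun i _ => Finset.sum_congr rfl fun j _ => by ring
  have hin : ⟪g, ξ⟫ = g.ofLp ⬝ᵥ ξ.ofLp := by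
    simp [EuclideanSpace.inner_eq_star_dotProduct, dotProduct_comm]
  have hng : ‖g‖ ^ 2 = ∑ k, g.ofLp k ^ 2 := by simp [EuclideanSpace.norm_sq_eq]
  have hnξ : ‖ξ‖ ^ 2 = ξ.ofLp ⬝ᵥ ξ.ofLp := by
    rw [EuclideanSpace.norm_sq_eq]
    simp [dotProduct, sq]
  simp only [moebiusHessian, hpd, Matrix.smul_mulVec, Matrix.sub_mulVec, Matrix.add_mulVec,
    Matrix.neg_mulVec, dotProduct_smul, dotProduct_sub, dotProduct_add, dotProduct_neg,
    Matrix.one_mulVec, ← hD, smul_eq_mul, ← hng, ← hnξ, Matrix.vecMulVec_mulVec]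
  simp only [hin, MulOpposite.smul_eq_mul_unop, MulOpposite.unop_op]
  rw [dotProduct_comm ξ.ofLp g.ofLp]
  ring

/-! ### Radial functions plus a linear one -/

/-- The function `y ↦ c + ⟪p, y⟫ + F (|y|²)`. -/
noncomputable def linearAddRadial (c : ℝ) (p : EuclideanSpace ℝ (Fin n)) (F : ℝ → ℝ)
    (y : EuclideanSpace ℝ (Fin n)) : ℝ :=
  c + ⟪p, y⟫ + F (‖y‖ ^ 2)

variable {c : ℝ} {p : EuclideanSpace ℝ (Fin n)} {F F' : ℝ → ℝ} {F'' : ℝ}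

lemma hasFDerivAt_linearAddRadial (hF : HasDerivAt F (F' (‖x‖ ^ 2)) (‖x‖ ^ 2)) :
    HasFDerivAt (linearAddRadial c p F) (innerSL ℝ (p + (2 * F' (‖x‖ ^ 2)) • x)) x := by
  have h1 : HasFDerivAt (fun y : EuclideanSpace ℝ (Fin n) => F (‖y‖ ^ 2))
      (F' (‖x‖ ^ 2) • (2 • innerSL ℝ x)) x :=
    hF.comp_hasFDerivAt x (hasStrictFDerivAt_norm_sq x).hasFDerivAt
  have h2 : HasFDerivAt (fun y : EuclideanSpace ℝ (Fin n) => ⟪p, y⟫) (innerSL ℝ p) x :=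
    (innerSL ℝ p).hasFDerivAt
  refine ((h2.const_add c).add h1).congr_fderiv ?_
  ext ξ
  simp
  ring

lemma fderiv_fderiv_linearAddRadial
    (hF : ∀ᶠ t in 𝓝 (‖x‖ ^ 2), HasDerivAt F (F' t) t) (hF' : HasDerivAt F' F'' (‖x‖ ^ 2))
    (ξ : EuclideanSpace ℝ (Fin n)) :
    fderiv ℝ (fderiv ℝ (linearAddRadial c p F)) x ξ ξ
      = 4 * F'' * ⟪x, ξ⟫ ^ 2 + 2 * F' (‖x‖ ^ 2) * ‖ξ‖ ^ 2 := by
  have hcont : ContinuousAt (fun y : EuclideanSpace ℝ (Fin n) => ‖y‖ ^ 2) x := by fun_prop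
  have hev : fderiv ℝ (linearAddRadial c p F) =ᶠ[𝓝 x]
      fun y => innerSL ℝ p + (2 * F' (‖y‖ ^ 2)) • innerSL ℝ y := by
    filter_upwards [hcont.eventually hF] with y hy
    rw [(hasFDerivAt_linearAddRadial hy).fderiv]
    simp
  have h1 : HasFDerivAt (fun y : EuclideanSpace ℝ (Fin n) => 2 * F' (‖y‖ ^ 2))
      ((2 * F'') • (2 • innerSL ℝ x)) x :=
    HasDerivAt.comp_hasFDerivAt (h₂ := fun t => 2 * F' t) x (hF'.const_mul 2)
      (hasStrictFDerivAt_norm_sq x).hasFDerivAt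
  have h2 : HasFDerivAt (fun y : EuclideanSpace ℝ (Fin n) => innerSL ℝ y) (innerSL ℝ) x :=
    (innerSL ℝ).hasFDerivAt
  have h3 : HasFDerivAt (fun y : EuclideanSpace ℝ (Fin n) =>
      innerSL ℝ p + (2 * F' (‖y‖ ^ 2)) • innerSL ℝ y) _ x := (h1.smul h2).const_add _
  rw [hev.fderiv_eq, h3.fderiv]
  change 2 * F' (‖x‖ ^ 2) * ⟪ξ, ξ⟫ + 2 * F'' * (2 • ⟪x, ξ⟫) * ⟪x, ξ⟫ = _
  rw [real_inner_self_eq_norm_sq, two_nsmul]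
  ring

lemma contDiffAt_linearAddRadial (hF : ContDiffAt ℝ 2 F (‖x‖ ^ 2)) :
    ContDiffAt ℝ 2 (linearAddRadial c p F) x := by
  have h1 : ContDiffAt ℝ 2 (fun y : EuclideanSpace ℝ (Fin n) => F (‖y‖ ^ 2)) x :=
    hF.comp x (contDiff_norm_sq ℝ).contDiffAt
  have h2 : ContDiffAt ℝ 2 (fun y : EuclideanSpace ℝ (Fin n) => ⟪p, y⟫) x :=
    (innerSL ℝ p).contDiff.contDiffAt
  exact (contDiffAt_const.add h2).add h1

/-! ### Second order conditions at a local maximum -/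

lemma IsLocalMax.deriv_deriv_nonpos {f : ℝ → ℝ} {a : ℝ} (h : IsLocalMax f a)
    (hc : ContinuousAt f a) : deriv (deriv f) a ≤ 0 := by
  by_contra! hpos
  -- a strict local minimum by the second derivative test, so `f` would be locally constant
  have hmin := isLocalMin_of_deriv_deriv_pos hpos h.deriv_eq_zero hc
  have hconst : f =ᶠ[𝓝 a] fun _ => f a := by
    filter_upwards [h, hmin] with y h1 h2 using le_antisymm h1 h2
  have := hconst.deriv.deriv_eq
  simp [this] at hpos

lemma IsLocalMax.fderiv_fderiv_nonpos (h : IsLocalMax φ x) (hφ : ContDiffAt ℝ 2 φ x)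
    (ξ : EuclideanSpace ℝ (Fin n)) : fderiv ℝ (fderiv ℝ φ) x ξ ξ ≤ 0 := by
  have hd : DifferentiableAt ℝ (fderiv ℝ φ) x :=
    (hφ.fderiv_right (m := 1) (by norm_num)).differentiableAt (by norm_num)
  have hline : ∀ s : ℝ, HasDerivAt (fun s : ℝ => x + s • ξ) ξ s := fun s => by
    simpa using ((hasDerivAt_id s).smul_const ξ).const_add x
  have hx0 : x + (0 : ℝ) • ξ = x := by simp
  have hcont : Tendsto (fun s : ℝ => x + s • ξ) (𝓝 0) (𝓝 x) := by
    simpa using (hline 0).continuousAt.tendsto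
  have hmax : IsLocalMax (fun s : ℝ => φ (x + s • ξ)) 0 := by
    filter_upwards [hcont.eventually h] with s hs
    simpa using hs
  have hev : ∀ᶠ y in 𝓝 x, DifferentiableAt ℝ φ y :=
    (hφ.eventually (by simp)).mono fun y hy => hy.differentiableAt (by norm_num)
  have hderiv : deriv (fun s : ℝ => φ (x + s • ξ)) =ᶠ[𝓝 0] fun s => fderiv ℝ φ (x + s • ξ) ξ := by
    filter_upwards [hcont.eventually hev] with s hs
    exact (hs.hasFDerivAt.comp_hasDerivAt s (hline s)).deriv
  have hc : ContinuousAt (fun s : ℝ => φ (x + s • ξ)) 0 := by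
    refine ContinuousAt.comp (f := fun s : ℝ => x + s • ξ) (g := φ) ?_ (hline 0).continuousAt
    simpa using hφ.continuousAt
  have h2 := hmax.deriv_deriv_nonpos hc
  have h3 : HasDerivAt (fun s : ℝ => fderiv ℝ φ (x + s • ξ)) (fderiv ℝ (fderiv ℝ φ) x ξ) 0 := by
    have : HasFDerivAt (fderiv ℝ φ) (fderiv ℝ (fderiv ℝ φ) x) (x + (0 : ℝ) • ξ) := by
      simpa using hd.hasFDerivAt
    exact this.comp_hasDerivAt (0 : ℝ) (hline 0)
  have h4 : HasDerivAt (fun s : ℝ => fderiv ℝ φ (x + s • ξ) ξ)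
      (fderiv ℝ (fderiv ℝ φ) x ξ ξ) 0 := by
    simpa using h3.clm_apply (hasDerivAt_const (0 : ℝ) ξ)
  rwa [hderiv.deriv_eq, h4.deriv] at h2

end Calculus

/-! ### The barrier -/

section Barrier

variable {n : ℕ}

open scoped RealInnerProductSpace

/-- The radial part `N t + β⁻¹ log (1 - ρ t ^ (-β))` of the barrier, in the variable `t = |x|²`.
It tends to `-∞` at the inner radius `t ^ β = ρ`. -/
noncomputable def barrierProfile (N β ρ t : ℝ) : ℝ :=
  N * t + β⁻¹ * Real.log (1 - ρ * t ^ (-β))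

/-- The derivative of `fun t ↦ β⁻¹ log (1 - ρ t ^ (-β))`. -/
noncomputable def barrierSlope (β ρ t : ℝ) : ℝ :=
  ρ * t ^ (-β - 1) / (1 - ρ * t ^ (-β))

variable {N β ρ t : ℝ}

lemma hasDerivAt_one_sub_mul_rpow (ht : 0 < t) :
    HasDerivAt (fun t : ℝ => 1 - ρ * t ^ (-β)) (ρ * (β * t ^ (-β - 1))) t := by
  have := ((Real.hasDerivAt_rpow_const (p := -β) (Or.inl ht.ne')).const_mul ρ).const_sub 1
  exact this.congr_deriv (by ring)

lemma hasDerivAt_barrierProfile (hβ : 0 < β) (ht : 0 < t) (h : 0 < 1 - ρ * t ^ (-β)) :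
    HasDerivAt (barrierProfile N β ρ) (N + barrierSlope β ρ t) t := by
  have h1 := (((hasDerivAt_one_sub_mul_rpow ht).log h.ne').const_mul β⁻¹)
  have h2 := ((hasDerivAt_id t).const_mul N).add h1
  refine h2.congr_deriv ?_
  rw [barrierSlope]
  field_simp

lemma hasDerivAt_barrierSlope (ht : 0 < t) (h : 0 < 1 - ρ * t ^ (-β)) :
    HasDerivAt (barrierSlope β ρ)
      (-(β + 1) * barrierSlope β ρ t / t - β * barrierSlope β ρ t ^ 2) t := by
  have h1 := (Real.hasDerivAt_rpow_const (p := -β - 1) (Or.inl ht.ne')).const_mul ρ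
  have h2 := h1.div (hasDerivAt_one_sub_mul_rpow ht) h.ne'
  refine h2.congr_deriv ?_
  rw [barrierSlope, Real.rpow_sub_one ht.ne' (-β - 1)]
  have h3 := h.ne'
  have h4 := ht.ne'
  generalize t ^ (-β - 1) = a at *
  generalize 1 - ρ * t ^ (-β) = b at *
  field_simp
  ring

lemma eventually_pos_one_sub_mul_rpow (ht : 0 < t) (h : 0 < 1 - ρ * t ^ (-β)) :
    ∀ᶠ s in 𝓝 t, 0 < s ∧ 0 < 1 - ρ * s ^ (-β) :=
  (lt_mem_nhds ht).and ((hasDerivAt_one_sub_mul_rpow ht).continuousAt.eventually (lt_mem_nhds h))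

lemma contDiffAt_barrierProfile (ht : 0 < t) (h : 0 < 1 - ρ * t ^ (-β)) :
    ContDiffAt ℝ 2 (barrierProfile N β ρ) t := by
  have h1 : ContDiffAt ℝ 2 (fun s : ℝ => s ^ (-β)) t :=
    Real.contDiffAt_rpow_const_of_ne ht.ne'
  have h2 : ContDiffAt ℝ 2 (fun s : ℝ => 1 - ρ * s ^ (-β)) t :=
    contDiffAt_const.sub (contDiffAt_const.mul h1)
  exact (contDiffAt_const.mul contDiffAt_id).add (contDiffAt_const.mul (h2.log h.ne'))

lemma barrierSlope_pos (hρ : 0 < ρ) (ht : 0 < t) (h : 0 < 1 - ρ * t ^ (-β)) :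
    0 < barrierSlope β ρ t :=
  div_pos (mul_pos hρ (Real.rpow_pos_of_pos ht _)) h

/-- The Möbius Hessian of the barrier is at most `σ ((2 + δ) e ⊗ e - I)` for `e = x / |x|` and
some `σ > 0`. The quadratic part `N |x|²` pays for the terms quadratic in `p`. -/
lemma exists_dotProduct_moebiusHessian_barrier_le {c τ δ : ℝ} {p x : EuclideanSpace ℝ (Fin n)}
    (hβ : 0 < β) (hβδ : 2 * β ≤ δ) (hτ : 0 < τ) (hτδ : 2 + 2 * β ≤ (2 + δ) * (1 - τ))
    (hρ : 0 < ρ) (hN : 0 ≤ N) (hx : x ≠ 0) (hpx : 3 * (‖p‖ * ‖x‖) ≤ τ / 2)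
    (hpN : ‖p‖ ^ 2 ≤ τ * (2 * N)) (h : 0 < 1 - ρ * (‖x‖ ^ 2) ^ (-β)) :
    ∃ σ : ℝ, 0 < σ ∧ ∀ ξ : EuclideanSpace ℝ (Fin n),
      ξ.ofLp ⬝ᵥ (moebiusHessian (linearAddRadial c p (barrierProfile N β ρ)) x).mulVec ξ.ofLp
        ≤ σ * ((2 + δ) * ⟪‖x‖⁻¹ • x, ξ⟫ ^ 2 - ‖ξ‖ ^ 2) := by
  have hr : 0 < ‖x‖ := norm_pos_iff.2 hx
  have ht : 0 < ‖x‖ ^ 2 := pow_pos hr 2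
  have hev : ∀ᶠ t in 𝓝 (‖x‖ ^ 2),
      HasDerivAt (barrierProfile N β ρ) (N + barrierSlope β ρ t) t :=
    (eventually_pos_one_sub_mul_rpow ht h).mono fun t ht =>
      hasDerivAt_barrierProfile hβ ht.1 ht.2
  have hF'' := (hasDerivAt_barrierSlope ht h).const_add N
  have hg := barrierSlope_pos hρ ht h
  have hC : ContDiffAt ℝ 2 (linearAddRadial c p (barrierProfile N β ρ)) x :=
    contDiffAt_linearAddRadial (contDiffAt_barrierProfile ht h)
  have hfd : HasFDerivAt (linearAddRadial c p (barrierProfile N β ρ)) _ x :=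
    hasFDerivAt_linearAddRadial (F' := fun t => N + barrierSlope β ρ t) hev.self_of_nhds
  set φ := linearAddRadial c p (barrierProfile N β ρ)
  set g := barrierSlope β ρ (‖x‖ ^ 2)
  set q : ℝ := 4 * (-(β + 1) * g / ‖x‖ ^ 2 - β * g ^ 2) with hq
  set s : ℝ := 2 * (N + g) with hs
  have hs0 : 0 < s := by positivity
  have hqt : -(q * ‖x‖ ^ 2) ≤ (2 + 2 * β) * s + β * s ^ 2 * ‖x‖ ^ 2 := by
    have h1 : -(q * ‖x‖ ^ 2) = (2 + 2 * β) * (2 * g) + β * (2 * g) ^ 2 * ‖x‖ ^ 2 := by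
      rw [hq]
      field_simp
      ring
    have h2 : 2 * g ≤ s := by rw [hs]; linarith
    rw [h1]
    gcongr
  have hτ1 : τ < 1 := by nlinarith
  set σ : ℝ := (1 - τ) * s + 1 / 2 * s ^ 2 * ‖x‖ ^ 2 with hσ
  have hσ0 : 0 < σ := add_pos_of_pos_of_nonneg (mul_pos (by linarith) hs0) (by positivity)
  have hmain : (s ^ 2 - q) * ‖x‖ ^ 2 ≤ (2 + δ) * σ := by
    have h1 := mul_le_mul_of_nonneg_right hτδ hs0.le
    have h2 : 0 ≤ (δ - 2 * β) * (s ^ 2 * ‖x‖ ^ 2) := mul_nonneg (by linarith) (by positivity)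
    rw [hσ]
    nlinarith
  refine ⟨Real.exp (-2 * φ x) * σ, by positivity, fun ξ => ?_⟩
  rw [dotProduct_moebiusHessian_mulVec hC hfd, fderiv_fderiv_linearAddRadial hev hF'',
    mul_assoc (Real.exp _) σ]
  refine mul_le_mul_of_nonneg_left ?_ (Real.exp_pos _).le
  rw [norm_add_sq_real, norm_smul, inner_add_left, real_inner_smul_left, real_inner_smul_left,
    real_inner_smul_right, Real.norm_of_nonneg hs0.le]
  have hP := abs_real_inner_le_norm p ξ
  have hX := abs_real_inner_le_norm x ξ
  have hZ := (abs_le.1 (abs_real_inner_le_norm p x)).1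
  have hPX : ⟪p, ξ⟫ * ⟪x, ξ⟫ ≤ (‖p‖ * ‖x‖) * ‖ξ‖ ^ 2 := by
    calc ⟪p, ξ⟫ * ⟪x, ξ⟫ ≤ |⟪p, ξ⟫| * |⟪x, ξ⟫| := by rw [← abs_mul]; exact le_abs_self _
      _ ≤ (‖p‖ * ‖ξ‖) * (‖x‖ * ‖ξ‖) := by gcongr
      _ = _ := by ring
  have hPP : ⟪p, ξ⟫ ^ 2 ≤ ‖p‖ ^ 2 * ‖ξ‖ ^ 2 := by
    rw [← sq_abs, ← mul_pow]
    gcongr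
  have hXX : ⟪x, ξ⟫ ^ 2 * (s ^ 2 - q) ≤ σ * ((2 + δ) * (‖x‖⁻¹ * ⟪x, ξ⟫) ^ 2) := by
    have h1 : σ * ((2 + δ) * (‖x‖⁻¹ * ⟪x, ξ⟫) ^ 2)
        = ⟪x, ξ⟫ ^ 2 * ((2 + δ) * σ / ‖x‖ ^ 2) := by
      field_simp
    rw [h1]
    exact mul_le_mul_of_nonneg_left ((le_div_iff₀ ht).2 hmain) (sq_nonneg _)
  have hk : 0 ≤ ‖ξ‖ ^ 2 := by positivity
  have hpN' : ‖p‖ ^ 2 ≤ τ * s :=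
    hpN.trans (mul_le_mul_of_nonneg_left (by rw [hs]; linarith) hτ.le)
  have e1 := mul_le_mul_of_nonneg_left hPX (by positivity : 0 ≤ 2 * s)
  have e2 := mul_le_mul_of_nonneg_right hZ (mul_nonneg hs0.le hk)
  have e3 := mul_le_mul_of_nonneg_right hpx (mul_nonneg hs0.le hk)
  have e4 := mul_le_mul_of_nonneg_right hpN' hk
  have e5 : s * ‖ξ‖ ^ 2 - σ * ‖ξ‖ ^ 2
      = τ * (s * ‖ξ‖ ^ 2) - 1 / 2 * (s * ‖x‖) ^ 2 * ‖ξ‖ ^ 2 := by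
    rw [hσ]; ring
  simp only [← hq]
  linarith

end Barrier

/-! ### Comparison with the barrier -/

section Comparison

variable {n : ℕ}

open scoped RealInnerProductSpace

lemma barrierProfile_le {N β ρ t : ℝ} (hβ : 0 < β) (hρ : 0 < ρ) (ht : 0 < t)
    (h : 0 < 1 - ρ * t ^ (-β)) : barrierProfile N β ρ t ≤ N * t := by
  have h1 : Real.log (1 - ρ * t ^ (-β)) ≤ 0 := by
    refine Real.log_nonpos h.le ?_
    have := mul_pos hρ (Real.rpow_pos_of_pos ht (-β))
    linarith
  have h2 := mul_nonpos_of_nonneg_of_nonpos (inv_pos.2 hβ).le h1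
  rw [barrierProfile]
  linarith

lemma tendsto_barrierProfile (N β t : ℝ) :
    Tendsto (fun ρ => barrierProfile N β ρ t) (𝓝[>] 0) (𝓝 (N * t)) := by
  have h : ContinuousAt (fun ρ => barrierProfile N β ρ t) 0 := by
    unfold barrierProfile
    refine continuousAt_const.add (continuousAt_const.mul (ContinuousAt.log (by fun_prop) ?_))
    simp
  simpa [barrierProfile] using h.tendsto.mono_left (nhdsWithin_le_nhds (s := Ioi 0))

lemma le_one_sub_mul_rpow_neg_iff {β ρ t E : ℝ} (ht : 0 < t) :
    E ≤ 1 - ρ * t ^ (-β) ↔ ρ ≤ (1 - E) * t ^ β := by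
  rw [le_sub_comm, Real.rpow_neg ht.le, ← div_eq_mul_inv, div_le_iff₀ (Real.rpow_pos_of_pos ht β)]

lemma isCompact_annulus {β ρ E r : ℝ} (hβ : 0 < β) :
    IsCompact {x : EuclideanSpace ℝ (Fin n) | ρ ≤ (1 - E) * (‖x‖ ^ 2) ^ β ∧ ‖x‖ ≤ r} := by
  have hcl : IsClosed {x : EuclideanSpace ℝ (Fin n) | ρ ≤ (1 - E) * (‖x‖ ^ 2) ^ β} :=
    isClosed_le continuous_const
      (continuous_const.mul ((Real.continuous_rpow_const hβ.le).comp (by fun_prop)))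
  have heq : {x : EuclideanSpace ℝ (Fin n) | ρ ≤ (1 - E) * (‖x‖ ^ 2) ^ β ∧ ‖x‖ ≤ r}
      = {x | ρ ≤ (1 - E) * (‖x‖ ^ 2) ^ β} ∩ Metric.closedBall 0 r := by
    ext x
    simp
  rw [heq]
  exact (isCompact_closedBall 0 r).inter_left hcl

lemma ne_zero_of_mem_annulus {β ρ E : ℝ} {x : EuclideanSpace ℝ (Fin n)} (hβ : 0 < β) (hρ : 0 < ρ)
    (hx : ρ ≤ (1 - E) * (‖x‖ ^ 2) ^ β) : x ≠ 0 := by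
  rintro rfl
  simp [Real.zero_rpow hβ.ne'] at hx
  linarith

/-- A lower semicontinuous function without the value `-∞` is bounded below on compact sets. -/
lemma LowerSemicontinuousOn.exists_forall_coe_le {X : Type*} [TopologicalSpace X] {s : Set X}
    {v : X → EReal} (hv : LowerSemicontinuousOn v s) (hs : IsCompact s)
    (hbot : ∀ x ∈ s, v x ≠ ⊥) : ∃ K : ℝ, ∀ x ∈ s, (K : EReal) ≤ v x := by
  rcases s.eq_empty_or_nonempty with rfl | hne
  · exact ⟨0, by simp⟩
  obtain ⟨z, hz, hmin⟩ := hv.exists_isMinOn hne hs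
  obtain ⟨K, -, hK⟩ := EReal.lt_iff_exists_real_btwn.1 (bot_lt_iff_ne_bot.2 (hbot z hz))
  exact ⟨K, fun x hx => hK.le.trans (hmin hx)⟩

/-- A lower semicontinuous `v` minus a continuous real function that is negative somewhere on a
compact set attains there a negative minimum; hence a translate touches `v` from below. -/
lemma LowerSemicontinuousOn.exists_touching {X : Type*} [TopologicalSpace X] {s : Set X}
    {v : X → EReal} {φ : X → ℝ} (hv : LowerSemicontinuousOn v s) (hs : IsCompact s)
    (hbot : ∀ x ∈ s, v x ≠ ⊥) (hφ : ContinuousOn φ s) {x₁ : X} (hx₁ : x₁ ∈ s)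
    (hlt : v x₁ < φ x₁) :
    ∃ x₂ ∈ s, ∃ m : ℝ, m < 0 ∧ v x₂ = ((m + φ x₂ : ℝ) : EReal) ∧
      ∀ x ∈ s, ((m + φ x : ℝ) : EReal) ≤ v x := by
  have hcont : ContinuousOn (fun x => ((-φ x : ℝ) : EReal)) s :=
    continuous_coe_real_ereal.comp_continuousOn hφ.neg
  have hu : LowerSemicontinuousOn (fun x => v x + ((-φ x : ℝ) : EReal)) s :=
    hv.add' hcont.lowerSemicontinuousOn fun x hx =>
      EReal.continuousAt_add (Or.inr (EReal.coe_ne_bot _)) (Or.inr (EReal.coe_ne_top _))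
  obtain ⟨x₂, hx₂, hmin⟩ := hu.exists_isMinOn ⟨x₁, hx₁⟩ hs
  have hmin : ∀ x ∈ s, v x₂ + ((-φ x₂ : ℝ) : EReal) ≤ v x + ((-φ x : ℝ) : EReal) := hmin
  have hneg : v x₂ + ((-φ x₂ : ℝ) : EReal) < 0 := by
    refine (hmin x₁ hx₁).trans_lt ?_
    have h1 := hbot x₁ hx₁
    generalize v x₁ = a at *
    induction a with
    | bot => exact absurd rfl h1
    | top => exact absurd hlt (by simp)
    | coe a =>
      have h2 : a < φ x₁ := by exact_mod_cast hlt
      have h3 : a + -φ x₁ < 0 := by linarith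
      exact_mod_cast h3
  obtain ⟨y, hy⟩ : ∃ y : ℝ, v x₂ = y := by
    have h1 := hbot x₂ hx₂
    generalize v x₂ = a at *
    induction a with
    | bot => exact absurd rfl h1
    | top => exact absurd hneg (by simp)
    | coe a => exact ⟨a, rfl⟩
  rw [hy] at hneg hmin
  refine ⟨x₂, hx₂, y + -φ x₂, by exact_mod_cast hneg, by rw [hy]; congr 1; ring, fun x hx => ?_⟩
  have h1 := hmin x hx
  have h2 := hbot x hx
  generalize v x = a at *
  induction a with
  | bot => exact absurd rfl h2
  | top => exact le_top
  | coe a =>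
    have h3 : y + -φ x₂ ≤ a + -φ x := by exact_mod_cast h1
    have h4 : y + -φ x₂ + φ x ≤ a := by linarith
    exact_mod_cast h4

/-- The comparison principle in a punctured ball: no information on `v` near the origin is
needed. -/
lemma IsViscositySupersolution.le_of_le_on_sphere {Γ : Set (Fin n → ℝ)}
    {v : EuclideanSpace ℝ (Fin n) → EReal} (hΓ : IsAdmissibleCone Γ)
    (hv : IsViscositySupersolution Γ (Metric.ball 0 1 \ {0}) v)
    (i₀ : Fin n) (hi₀ : (i₀ : ℕ) = 0) {β τ δ : ℝ}
    (hδ : 0 < δ) (hlam : lambdaStar n + Pi.single i₀ δ ∉ closure Γ)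
    (hβ : 0 < β) (hβδ : 2 * β ≤ δ) (hτ : 0 < τ) (hτδ : 2 + 2 * β ≤ (2 + δ) * (1 - τ))
    {N c r : ℝ} {p : EuclideanSpace ℝ (Fin n)} (hN : 0 ≤ N) (hr1 : r < 1)
    (hpr : 3 * (‖p‖ * r) ≤ τ / 2) (hpN : ‖p‖ ^ 2 ≤ τ * (2 * N))
    (hbd : ∀ x : EuclideanSpace ℝ (Fin n), ‖x‖ = r →
      ((c + ⟪p, x⟫ + N * ‖x‖ ^ 2 : ℝ) : EReal) ≤ v x)
    {x : EuclideanSpace ℝ (Fin n)} (hx0 : x ≠ 0) (hxr : ‖x‖ < r) :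
    ((c + ⟪p, x⟫ + N * ‖x‖ ^ 2 : ℝ) : EReal) ≤ v x := by
  by_contra! hlt
  obtain ⟨⟨hbot, -, hlsc⟩, htest⟩ := hv
  have hnorm : ∀ {y : EuclideanSpace ℝ (Fin n)}, y ≠ 0 → 0 < ‖y‖ ^ 2 := fun hy =>
    pow_pos (norm_pos_iff.2 hy) 2
  have hmem : ∀ {y : EuclideanSpace ℝ (Fin n)}, y ≠ 0 → ‖y‖ ≤ r → y ∈ Metric.ball 0 1 \ {0} :=
    fun hy hyr => ⟨by simpa using hyr.trans_lt hr1, hy⟩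
  -- the barrier converges to the quadratic polynomial as the inner radius tends to zero
  obtain ⟨ρ, hρ, hρx, hφx⟩ : ∃ ρ : ℝ, 0 < ρ ∧ 0 < 1 - ρ * (‖x‖ ^ 2) ^ (-β) ∧
      v x < linearAddRadial c p (barrierProfile N β ρ) x := by
    have h1 : Tendsto (fun ρ => ((linearAddRadial c p (barrierProfile N β ρ) x : ℝ) : EReal))
        (𝓝[>] 0) (𝓝 ((c + ⟪p, x⟫ + N * ‖x‖ ^ 2 : ℝ) : EReal)) :=
      (continuous_coe_real_ereal.tendsto _).comp
        ((tendsto_barrierProfile N β (‖x‖ ^ 2)).const_add _)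
    have h2 : ∀ᶠ ρ : ℝ in 𝓝[>] 0, 0 < 1 - ρ * (‖x‖ ^ 2) ^ (-β) := by
      have : ContinuousAt (fun ρ : ℝ => 1 - ρ * (‖x‖ ^ 2) ^ (-β)) 0 := by fun_prop
      exact nhdsWithin_le_nhds (this.eventually (lt_mem_nhds (by simp)))
    obtain ⟨ρ, ⟨h3, h4⟩, h5⟩ :=
      ((h1.eventually (lt_mem_nhds hlt)).and h2 |>.and self_mem_nhdsWithin).exists
    exact ⟨ρ, h5, h4, h3⟩
  set φ := linearAddRadial c p (barrierProfile N β ρ) with hφ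
  obtain ⟨K, hK⟩ : ∃ K : ℝ, ∀ y ∈ {y : EuclideanSpace ℝ (Fin n) |
      ρ ≤ (1 - 0) * (‖y‖ ^ 2) ^ β ∧ ‖y‖ ≤ r}, (K : EReal) ≤ v y := by
    refine LowerSemicontinuousOn.exists_forall_coe_le (hlsc.mono ?_) (isCompact_annulus hβ) ?_
    · exact fun y hy => hmem (ne_zero_of_mem_annulus hβ hρ hy.1) hy.2
    · exact fun y hy => hbot y (hmem (ne_zero_of_mem_annulus hβ hρ hy.1) hy.2)
  -- close to the inner sphere the barrier lies below this lower bound of `v`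
  set E : ℝ := Real.exp (β * min (-1) (K - (c + ‖p‖ * r + N * r ^ 2))) with hE
  have hE0 : 0 < E := Real.exp_pos _
  have hE1 : E < 1 := by
    rw [hE, Real.exp_lt_one_iff]
    exact mul_neg_of_pos_of_neg hβ (by simp)
  have hφK : ∀ y : EuclideanSpace ℝ (Fin n), ‖y‖ ≤ r → 0 < 1 - ρ * (‖y‖ ^ 2) ^ (-β) →
      1 - ρ * (‖y‖ ^ 2) ^ (-β) ≤ E → φ y ≤ K := by
    intro y hyr hy0 hyE
    have h1 : β⁻¹ * Real.log (1 - ρ * (‖y‖ ^ 2) ^ (-β)) ≤ K - (c + ‖p‖ * r + N * r ^ 2) := by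
      have h2 := Real.log_le_log hy0 hyE
      rw [hE, Real.log_exp] at h2
      rw [inv_mul_le_iff₀ hβ]
      exact h2.trans (mul_le_mul_of_nonneg_left (min_le_right _ _) hβ.le)
    have h2 : ⟪p, y⟫ ≤ ‖p‖ * r :=
      (real_inner_le_norm p y).trans (mul_le_mul_of_nonneg_left hyr (norm_nonneg p))
    have h3 : N * ‖y‖ ^ 2 ≤ N * r ^ 2 := by gcongr
    rw [hφ, linearAddRadial, barrierProfile]
    linarith
  set A : Set (EuclideanSpace ℝ (Fin n)) :=
    {y | ρ ≤ (1 - E) * (‖y‖ ^ 2) ^ β ∧ ‖y‖ ≤ r} with hA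
  have hA0 : ∀ y ∈ A, y ≠ 0 := fun y hy => ne_zero_of_mem_annulus hβ hρ hy.1
  have hAE : ∀ y ∈ A, E ≤ 1 - ρ * (‖y‖ ^ 2) ^ (-β) := fun y hy =>
    (le_one_sub_mul_rpow_neg_iff (hnorm (hA0 y hy))).2 hy.1
  have hKv : ∀ y : EuclideanSpace ℝ (Fin n), y ≠ 0 → ‖y‖ ≤ r →
      0 < 1 - ρ * (‖y‖ ^ 2) ^ (-β) → (K : EReal) ≤ v y := fun y hy hyr hpos =>
    hK y ⟨(le_one_sub_mul_rpow_neg_iff (hnorm hy)).1 hpos.le, hyr⟩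
  have hxA : x ∈ A := by
    refine ⟨(le_one_sub_mul_rpow_neg_iff (hnorm hx0)).1 ?_, hxr.le⟩
    by_contra! hxE
    have h1 : (φ x : EReal) ≤ K := by exact_mod_cast hφK x hxr.le hρx hxE.le
    exact absurd hφx (not_lt.2 (h1.trans (hKv x hx0 hxr.le hρx)))
  have hCD : ∀ (c' : ℝ), ∀ y ∈ A, ContDiffAt ℝ 2
      (linearAddRadial c' p (barrierProfile N β ρ)) y := fun c' y hy =>
    contDiffAt_linearAddRadial
      (contDiffAt_barrierProfile (hnorm (hA0 y hy)) (hE0.trans_le (hAE y hy)))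
  obtain ⟨z, hz, m, hm, hvz, hmin⟩ := LowerSemicontinuousOn.exists_touching (φ := φ)
    (hlsc.mono fun y hy => hmem (hA0 y hy) hy.2) (isCompact_annulus hβ)
    (fun y hy => hbot y (hmem (hA0 y hy) hy.2))
    (fun y hy => (hCD c y hy).continuousAt.continuousWithinAt) hxA hφx
  have hz0 := hA0 z hz
  have hzpos := hE0.trans_le (hAE z hz)
  have hvlt : v z < φ z := by
    rw [hvz]
    exact_mod_cast (by linarith : m + φ z < φ z)
  have hzr : ‖z‖ < r := by
    refine lt_of_le_of_ne hz.2 fun hzr => ?_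
    have h1 : φ z ≤ c + ⟪p, z⟫ + N * ‖z‖ ^ 2 := by
      have := barrierProfile_le (N := N) hβ hρ (hnorm hz0) hzpos
      rw [hφ, linearAddRadial]
      linarith
    exact absurd hvlt (not_lt.2 ((EReal.coe_le_coe_iff.2 h1).trans (hbd z hzr)))
  have hzE : E < 1 - ρ * (‖z‖ ^ 2) ^ (-β) := by
    by_contra! hzE
    have h1 : (φ z : EReal) ≤ K := by exact_mod_cast hφK z hz.2 hzpos hzE
    exact absurd hvlt (not_lt.2 (h1.trans (hKv z hz0 hz.2 hzpos)))
  have hnhds : ∀ᶠ y in 𝓝 z, y ∈ A := by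
    have hc : ContinuousAt (fun y : EuclideanSpace ℝ (Fin n) => ‖y‖ ^ 2) z := by fun_prop
    have h1 := hc.eventually (((hasDerivAt_one_sub_mul_rpow
      (ρ := ρ) (β := β) (hnorm hz0)).continuousAt.eventually (lt_mem_nhds hzE)))
    have h2 := continuous_norm.continuousAt.eventually (gt_mem_nhds hzr)
    filter_upwards [h1, h2, isOpen_ne.mem_nhds hz0] with y h1 h2 h3
    exact ⟨(le_one_sub_mul_rpow_neg_iff (hnorm h3)).1 h1.le, h2.le⟩
  have hshift : ∀ y, linearAddRadial (m + c) p (barrierProfile N β ρ) y = m + φ y := fun y => by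
    simp only [hφ, linearAddRadial]
    ring
  have hin := htest z (hmem hz0 hz.2) (linearAddRadial (m + c) p (barrierProfile N β ρ))
    (hCD _ z hz) (by rw [hshift, hvz])
    (hnhds.mono fun y hy => by rw [hshift]; exact hmin y hy)
  have hpz : 3 * (‖p‖ * ‖z‖) ≤ τ / 2 := by
    have := mul_le_mul_of_nonneg_left hz.2 (norm_nonneg p)
    linarith
  obtain ⟨σ, hσ, hQ⟩ := exists_dotProduct_moebiusHessian_barrier_le (c := m + c) hβ hβδ hτ hτδ hρ
    hN hz0 hpz hpN hzpos
  exact hlam (hΓ.lambdaStar_add_mem_closure hin i₀ hi₀ (norm_smul_inv_norm (𝕜 := ℝ) hz0)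
    hσ hδ hQ)

end Comparison

/-! ### The removable singularity -/

section Removable

variable {n : ℕ}

open scoped RealInnerProductSpace

/-- As `λ*` lies off the closed set `closure Γ`, so does `λ* + δ e₀` for small `δ > 0`. -/
lemma exists_lambdaStar_add_notMem_closure {Γ : Set (Fin n → ℝ)} (i₀ : Fin n)
    (hlam : lambdaStar n ∉ closure Γ) :
    ∃ δ : ℝ, 0 < δ ∧ lambdaStar n + Pi.single i₀ δ ∉ closure Γ := by
  have hc : Continuous fun δ : ℝ => lambdaStar n + Pi.single i₀ δ :=
    continuous_const.add (continuous_single (A := fun _ : Fin n => ℝ) i₀)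
  have h1 : ∀ᶠ δ : ℝ in 𝓝 0, lambdaStar n + Pi.single i₀ δ ∈ (closure Γ)ᶜ :=
    hc.continuousAt.eventually (isClosed_closure.isOpen_compl.mem_nhds (by simpa using hlam))
  have h2 : ∀ᶠ δ : ℝ in 𝓝[>] 0, lambdaStar n + Pi.single i₀ δ ∈ (closure Γ)ᶜ :=
    nhdsWithin_le_nhds h1
  obtain ⟨δ, h3, h4⟩ := (h2.and self_mem_nhdsWithin).exists
  exact ⟨δ, h4, h3⟩

/-- Comparison with an affine function plus `N |x|²`: the constant `τ` says how small the radius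
and how large `N` must be in terms of the slope `p`. -/
lemma IsViscositySupersolution.exists_comparison {Γ : Set (Fin n → ℝ)}
    {v : EuclideanSpace ℝ (Fin n) → EReal} (hΓ : IsAdmissibleCone Γ) (hn : 0 < n)
    (hlam : lambdaStar n ∉ closure Γ)
    (hv : IsViscositySupersolution Γ (Metric.ball 0 1 \ {0}) v) :
    ∃ τ : ℝ, 0 < τ ∧ ∀ (N c r : ℝ) (p : EuclideanSpace ℝ (Fin n)), 0 ≤ N → r < 1 →
      3 * (‖p‖ * r) ≤ τ / 2 → ‖p‖ ^ 2 ≤ τ * (2 * N) →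
      (∀ x : EuclideanSpace ℝ (Fin n), ‖x‖ = r →
        ((c + ⟪p, x⟫ + N * ‖x‖ ^ 2 : ℝ) : EReal) ≤ v x) →
      ∀ x : EuclideanSpace ℝ (Fin n), x ≠ 0 → ‖x‖ < r →
        ((c + ⟪p, x⟫ + N * ‖x‖ ^ 2 : ℝ) : EReal) ≤ v x := by
  obtain ⟨δ, hδ, hlam'⟩ := exists_lambdaStar_add_notMem_closure ⟨0, hn⟩ hlam
  have hδ2 : 0 < 2 * (2 + δ) := by positivity
  refine ⟨δ / (2 * (2 + δ)), by positivity, fun N c r p hN hr hpr hpN hbd x hx hxr => ?_⟩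
  refine hv.le_of_le_on_sphere hΓ ⟨0, hn⟩ rfl hδ hlam' (β := δ / 4) (by positivity) (by linarith)
    (by positivity) ?_ hN hr hpr hpN hbd hx hxr
  have h1 : (2 + δ) * (1 - δ / (2 * (2 + δ))) = 2 + δ / 2 := by
    field_simp
    ring
  rw [h1]
  linarith

lemma IsViscositySupersolution.bot_lt_liminf {Γ : Set (Fin n → ℝ)}
    {v : EuclideanSpace ℝ (Fin n) → EReal} (hΓ : IsAdmissibleCone Γ) (hn : 0 < n)
    (hlam : lambdaStar n ∉ closure Γ)
    (hv : IsViscositySupersolution Γ (Metric.ball 0 1 \ {0}) v) :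
    ⊥ < liminf v (𝓝[≠] 0) := by
  obtain ⟨τ, hτ, hcomp⟩ := hv.exists_comparison hΓ hn hlam
  have hsub : Metric.sphere (0 : EuclideanSpace ℝ (Fin n)) (1 / 2) ⊆ Metric.ball 0 1 \ {0} := by
    intro x hx
    have hx' : ‖x‖ = 1 / 2 := by simpa using hx
    refine ⟨by simp [hx']; norm_num, ?_⟩
    rintro rfl
    simp at hx'
  obtain ⟨K, hK⟩ := (hv.1.2.2.mono hsub).exists_forall_coe_le (isCompact_sphere 0 (1 / 2))
    fun x hx => hv.1.1 x (hsub hx)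
  have h1 := hcomp 0 K (1 / 2) 0 le_rfl (by norm_num) (by simpa using by positivity) (by simp)
    fun x hx => by simpa using hK x (by simpa using hx)
  refine (EReal.bot_lt_coe K).trans_le (le_liminf_of_le (by isBoundedDefault) ?_)
  have h2 : ∀ᶠ x : EuclideanSpace ℝ (Fin n) in 𝓝[≠] 0, ‖x‖ < 1 / 2 :=
    nhdsWithin_le_nhds (continuous_norm.continuousAt.eventually (gt_mem_nhds (by simp)))
  filter_upwards [h2, self_mem_nhdsWithin] with x hx hx0
  simpa using h1 x hx0 hx

lemma IsLSC.update_liminf {v : EuclideanSpace ℝ (Fin n) → EReal}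
    (hv : IsLSC (Metric.ball 0 1 \ {0}) v) (hlim : ⊥ < liminf v (𝓝[≠] 0)) :
    IsLSC (Metric.ball 0 1) (Function.update v 0 (liminf v (𝓝[≠] 0))) := by
  obtain ⟨hbot, ⟨x₁, hx₁, htop⟩, hlsc⟩ := hv
  refine ⟨fun x hx => ?_, ⟨x₁, hx₁.1, ?_⟩, fun x hx => ?_⟩
  · by_cases h0 : x = 0
    · subst h0
      simpa using hlim.ne'
    · rw [Function.update_of_ne h0]
      exact hbot x ⟨hx, h0⟩
  · rwa [Function.update_of_ne hx₁.2]
  · intro y hy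
    refine nhdsWithin_le_nhds ?_
    by_cases h0 : x = 0
    · subst h0
      rw [Function.update_self] at hy
      have h1 := eventually_nhdsWithin_iff.1 (eventually_lt_of_lt_liminf hy)
      filter_upwards [h1] with z hz
      by_cases hz0 : z = 0
      · subst hz0
        simpa using hy
      · rw [Function.update_of_ne hz0]
        exact hz hz0
    · have hopen : IsOpen (Metric.ball (0 : EuclideanSpace ℝ (Fin n)) 1 \ {0}) :=
        Metric.isOpen_ball.sdiff isClosed_singleton
      rw [Function.update_of_ne h0] at hy
      have h1 := hlsc x ⟨hx, h0⟩ y hy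
      rw [hopen.nhdsWithin_eq ⟨hx, h0⟩] at h1
      filter_upwards [h1, isOpen_ne.mem_nhds h0] with z hz hz0
      rwa [Function.update_of_ne hz0]

lemma EReal.add_le_of_sub_nonneg {a : EReal} {b L d e : ℝ} (ha : a ≠ ⊥)
    (h : 0 ≤ (a - (b : EReal)) - ((L : EReal) - (d : EReal)) - (e : EReal)) :
    ((L + (b - d) + e : ℝ) : EReal) ≤ a := by
  induction a with
  | bot => exact absurd rfl ha
  | top => exact le_top
  | coe a =>
    have h1 : 0 ≤ (a - b) - (L - d) - e := by exact_mod_cast h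
    have h2 : L + (b - d) + e ≤ a := by linarith
    exact_mod_cast h2

/-- If a smooth `η` plus `ε |x|` stayed below `v`, touching at the origin, the term `ε |x|` would lift `v`
on a small sphere by `ε r / 2` above the linearization of `η`, hence, by comparison, in the whole
punctured ball: this contradicts the definition of `v 0` as a lower limit. -/
lemma IsViscositySupersolution.isLowerConicalAt {Γ : Set (Fin n → ℝ)}
    {v : EuclideanSpace ℝ (Fin n) → EReal} (hΓ : IsAdmissibleCone Γ) (hn : 0 < n)
    (hlam : lambdaStar n ∉ closure Γ)
    (hv : IsViscositySupersolution Γ (Metric.ball 0 1 \ {0}) v) :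
    IsLowerConicalAt (Metric.ball 0 1) (Function.update v 0 (liminf v (𝓝[≠] 0))) 0 := by
  have hbot := hv.bot_lt_liminf hΓ hn hlam
  have hlsc := hv.1.update_liminf hbot
  refine ⟨hlsc, by simp, or_iff_not_imp_left.2 fun htop => ⟨lt_top_iff_ne_top.2 htop, ?_⟩⟩
  intro ε hε η hη
  by_contra! hcon
  rw [Function.update_self] at htop hcon
  obtain ⟨τ, hτ, hcomp⟩ := hv.exists_comparison hΓ hn hlam
  obtain ⟨L, hL⟩ : ∃ L : ℝ, liminf v (𝓝[≠] 0) = L :=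
    ⟨_, (EReal.coe_toReal htop hbot.ne').symm⟩
  have hlow : ∀ x : EuclideanSpace ℝ (Fin n), x ≠ 0 → ‖x‖ < 1 →
      ((L + (η x - η 0) + ε * ‖x‖ : ℝ) : EReal) ≤ v x := by
    intro x hx0 hx1
    have hx : x ∈ Metric.ball (0 : EuclideanSpace ℝ (Fin n)) 1 := by simpa using hx1
    have h1 := (le_iInf₂_iff.1 hcon) x hx
    rw [Function.update_of_ne hx0, hL, sub_zero] at h1
    exact EReal.add_le_of_sub_nonneg (hv.1.1 x ⟨hx, hx0⟩) h1
  have hdiff : DifferentiableAt ℝ η 0 :=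
    (hη.contDiffAt (Metric.isOpen_ball.mem_nhds (by simp))).differentiableAt (by simp)
  set p := gradient η 0
  have hgrad : ∀ᶠ x : EuclideanSpace ℝ (Fin n) in 𝓝 0,
      ‖η x - η 0 - ⟪p, x⟫‖ ≤ ε / 4 * ‖x‖ := by
    have h1 := hasGradientAt_iff_isLittleO.1 hdiff.hasGradientAt
    have h2 := h1.def (by positivity : 0 < ε / 4)
    simpa only [sub_zero, InnerProductSpace.toDual_apply_apply] using h2
  obtain ⟨R, hR, hball⟩ := Metric.eventually_nhds_iff.1 hgrad
  set N : ℝ := ‖p‖ ^ 2 / (2 * τ) with hN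
  -- on the sphere of radius `r` the quadratic term costs at most `ε r / 4`
  obtain ⟨r, hr0, hr1, hrR, hpr, hNr⟩ : ∃ r : ℝ, 0 < r ∧ r < 1 ∧ r < R ∧
      3 * (‖p‖ * r) < τ / 2 ∧ N * r < ε / 4 := by
    have h0 : ∀ᶠ r : ℝ in 𝓝 0, r < 1 ∧ r < R ∧ 3 * (‖p‖ * r) < τ / 2 ∧ N * r < ε / 4 := by
      refine (gt_mem_nhds one_pos).and ((gt_mem_nhds hR).and (.and ?_ ?_))
      · have : ContinuousAt (fun r : ℝ => 3 * (‖p‖ * r)) 0 := by fun_prop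
        exact this.eventually (gt_mem_nhds (by simpa using hτ))
      · have : ContinuousAt (fun r : ℝ => N * r) 0 := by fun_prop
        exact this.eventually (gt_mem_nhds (by simpa using hε))
    have h1 : ∀ᶠ r : ℝ in 𝓝[>] 0, r < 1 ∧ r < R ∧ 3 * (‖p‖ * r) < τ / 2 ∧ N * r < ε / 4 :=
      nhdsWithin_le_nhds h0
    obtain ⟨r, h2, h3⟩ := (h1.and self_mem_nhdsWithin).exists
    exact ⟨r, h3, h2⟩
  have hsphere : ∀ x : EuclideanSpace ℝ (Fin n), ‖x‖ = r →
      ((L + ε * r / 2 + ⟪p, x⟫ + N * ‖x‖ ^ 2 : ℝ) : EReal) ≤ v x := by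
    intro x hx
    have hx0 : x ≠ 0 := norm_pos_iff.1 (hx ▸ hr0)
    refine le_trans (EReal.coe_le_coe_iff.2 ?_) (hlow x hx0 (hx ▸ hr1))
    have h1 := (abs_le.1 (hball (y := x) (by simpa [hx] using hrR))).1
    have h2 := mul_le_mul_of_nonneg_right hNr.le hr0.le
    rw [hx] at h1 ⊢
    nlinarith
  have hlift := hcomp N (L + ε * r / 2) r p (by positivity) hr1 hpr.le
    (by rw [hN]; apply le_of_eq; field_simp) hsphere
  have hlim : ((L + ε * r / 4 : ℝ) : EReal) ≤ liminf v (𝓝[≠] 0) := by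
    refine le_liminf_of_le (by isBoundedDefault) ?_
    have h1 : ∀ᶠ x : EuclideanSpace ℝ (Fin n) in 𝓝[≠] 0, ‖x‖ < r :=
      nhdsWithin_le_nhds (continuous_norm.continuousAt.eventually (gt_mem_nhds (by simpa)))
    have h2 : ∀ᶠ x : EuclideanSpace ℝ (Fin n) in 𝓝[≠] 0, -(ε * r / 4) < ⟪p, x⟫ := by
      have : ContinuousAt (fun x : EuclideanSpace ℝ (Fin n) => ⟪p, x⟫) 0 := by fun_prop
      exact nhdsWithin_le_nhds (this.eventually (lt_mem_nhds (by simp; positivity)))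
    filter_upwards [h1, h2, self_mem_nhdsWithin] with x hx hpx hx0
    refine le_trans (EReal.coe_le_coe_iff.2 ?_) (hlift x hx0 hx)
    have : 0 ≤ N * ‖x‖ ^ 2 := by positivity
    linarith
  rw [hL, EReal.coe_le_coe_iff] at hlim
  have : 0 < ε * r := mul_pos hε hr0
  linarith

end Removable

/-! ### The logarithm as a singular supersolution -/

section Logarithm

variable {n : ℕ}

open scoped RealInnerProductSpace

lemma isViscositySupersolution_log_norm {Γ : Set (Fin n → ℝ)} (hΓ : IsAdmissibleCone Γ)
    (hn : 0 < n) (hlam : lambdaStar n ∈ closure Γ) :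
    IsViscositySupersolution Γ (Metric.ball 0 1 \ {0})
      fun x : EuclideanSpace ℝ (Fin n) => ((Real.log ‖x‖ : ℝ) : EReal) := by
  refine ⟨⟨fun x _ => EReal.coe_ne_bot _, ⟨EuclideanSpace.single ⟨0, hn⟩ (1 / 2), ?_,
    EReal.coe_ne_top _⟩, ?_⟩, fun x hx φ hφ heq hle => ?_⟩
  · constructor
    · simp; norm_num
    · simp
  · refine ContinuousOn.lowerSemicontinuousOn ?_
    refine continuous_coe_real_ereal.comp_continuousOn (continuous_norm.continuousOn.log ?_)
    exact fun x hx => norm_ne_zero_iff.2 hx.2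
  have hx0 : x ≠ 0 := hx.2
  have hr : 0 < ‖x‖ := norm_pos_iff.2 hx0
  have ht : 0 < ‖x‖ ^ 2 := pow_pos hr 2
  set V : EuclideanSpace ℝ (Fin n) → ℝ := linearAddRadial 0 0 fun t => 1 / 2 * Real.log t with hV
  have hVlog : ∀ y, V y = Real.log ‖y‖ := fun y => by
    simp [hV, linearAddRadial, Real.log_pow]
  have hev : ∀ᶠ t in 𝓝 (‖x‖ ^ 2),
      HasDerivAt (fun t => 1 / 2 * Real.log t) (1 / 2 * t⁻¹) t :=
    (lt_mem_nhds ht).mono fun t ht => (Real.hasDerivAt_log ht.ne').const_mul _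
  have hF'' : HasDerivAt (fun t : ℝ => 1 / 2 * t⁻¹) (1 / 2 * -((‖x‖ ^ 2) ^ 2)⁻¹) (‖x‖ ^ 2) :=
    (hasDerivAt_inv ht.ne').const_mul _
  have hVC : ContDiffAt ℝ 2 V x := contDiffAt_linearAddRadial
    (contDiffAt_const.mul (Real.contDiffAt_log.2 ht.ne'))
  have hVd : HasFDerivAt V _ x :=
    hasFDerivAt_linearAddRadial (F' := fun t => 1 / 2 * t⁻¹) hev.self_of_nhds
  have hmax : IsLocalMax (fun y => φ y - V y) x := by
    have h0 : φ x = V x := by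
      rw [hVlog]
      exact EReal.coe_eq_coe_iff.1 heq
    filter_upwards [hle] with y hy
    have h1 : φ y ≤ V y := by
      rw [hVlog]
      exact EReal.coe_le_coe_iff.1 hy
    linarith
  have hφd := hφ.differentiableAt (by norm_num)
  have hφd' : HasFDerivAt φ (innerSL ℝ (0 + (2 * (1 / 2 * (‖x‖ ^ 2)⁻¹)) • x)) x := by
    have h1 := hmax.fderiv_eq_zero
    rw [fderiv_fun_sub hφd hVd.differentiableAt, sub_eq_zero, hVd.fderiv] at h1
    rw [← h1]
    exact hφd.hasFDerivAt
  have hD : ∀ ξ, fderiv ℝ (fderiv ℝ φ) x ξ ξ ≤ fderiv ℝ (fderiv ℝ V) x ξ ξ := by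
    intro ξ
    have h1 := hmax.fderiv_fderiv_nonpos (hφ.sub hVC) ξ
    have h2 : fderiv ℝ (fun y => φ y - V y) =ᶠ[𝓝 x] fun y => fderiv ℝ φ y - fderiv ℝ V y := by
      filter_upwards [hφ.eventually (by simp), hVC.eventually (by simp)] with y h1 h2
      exact fderiv_fun_sub (h1.differentiableAt (by norm_num)) (h2.differentiableAt (by norm_num))
    rw [h2.fderiv_eq, fderiv_fun_sub
      ((hφ.fderiv_right (m := 1) (by norm_num)).differentiableAt (by norm_num))
      ((hVC.fderiv_right (m := 1) (by norm_num)).differentiableAt (by norm_num))] at h1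
    simpa using h1
  refine hΓ.eigenvaluesIn_closure hlam (isHermitian_moebiusHessian hφ) ⟨0, hn⟩ rfl
    (e := ‖x‖⁻¹ • x) (norm_smul_inv_norm (𝕜 := ℝ) hx0)
    (κ := Real.exp (-2 * φ x) * (3 / 2 * (‖x‖ ^ 2)⁻¹)) (by positivity) fun ξ => ?_
  rw [dotProduct_moebiusHessian_mulVec hφ hφd', mul_assoc]
  refine mul_le_mul_of_nonneg_left ?_ (Real.exp_pos _).le
  have h1 := hD ξ
  rw [fderiv_fderiv_linearAddRadial hev hF''] at h1
  refine le_trans (le_of_eq ?_) (sub_le_sub_right (add_le_add_left (neg_le_neg h1) _) _)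
  rw [zero_add, norm_smul, real_inner_smul_left, real_inner_smul_left,
    Real.norm_of_nonneg (by positivity)]
  field_simp
  ring

lemma tendsto_log_norm_nhdsNE :
    Tendsto (fun x : EuclideanSpace ℝ (Fin n) => ((Real.log ‖x‖ : ℝ) : EReal)) (𝓝[≠] 0) (𝓝 ⊥) := by
  have h1 : Tendsto (fun x : EuclideanSpace ℝ (Fin n) => ‖x‖) (𝓝[≠] 0) (𝓝[>] 0) :=
    tendsto_norm_nhdsNE_zero
  exact EReal.tendsto_coe_atBot.comp (Real.tendsto_log_nhdsGT_zero.comp h1)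

end Logarithm

theorem proposition4 (n : ℕ) (hn : 2 ≤ n) (Γ : Set (Fin n → ℝ)) (hΓ : IsAdmissibleCone Γ) :
    (lambdaStar n ∉ closure Γ →
      ∀ v : EuclideanSpace ℝ (Fin n) → EReal,
        IsViscositySupersolution Γ (Metric.ball 0 1 \ {0}) v →
          ⊥ < liminf v (𝓝[≠] 0) ∧
          IsLSC (Metric.ball 0 1) (Function.update v 0 (liminf v (𝓝[≠] 0))) ∧
          IsLowerConicalAt (Metric.ball 0 1) (Function.update v 0 (liminf v (𝓝[≠] 0))) 0) ∧
    (lambdaStar n ∈ closure Γ →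
      ∃ v : EuclideanSpace ℝ (Fin n) → EReal,
        IsViscositySupersolution Γ (Metric.ball 0 1 \ {0}) v ∧
          liminf v (𝓝[≠] 0) = ⊥) := by
  have hn0 : 0 < n := by omega
  refine ⟨fun hlam v hv => ?_, fun hlam => ?_⟩
  · have hbot := hv.bot_lt_liminf hΓ hn0 hlam
    exact ⟨hbot, hv.1.update_liminf hbot, hv.isLowerConicalAt hΓ hn0 hlam⟩
  · have : Nontrivial (EuclideanSpace ℝ (Fin n)) :=
      ⟨EuclideanSpace.single ⟨0, hn0⟩ 1, 0, by simp⟩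
    exact ⟨_, isViscositySupersolution_log_norm hΓ hn0 hlam, tendsto_log_norm_nhdsNE.liminf_eq⟩
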